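/- A total query search problem consists of a relation $R\subseteq\{0,1\}^n\times\mathcal O$ such that every $x\in\{0,1\}^n$ has some $o\in\mathcal O$ with $R(x,o)$; its size is the number $n$ of input bits. For two such problems $R\subseteq\{0,1\}^n\times\mathcal O$ and $S\subseteq\{0,1\}^m\times\mathcal O'$, an $S$-formulation of $R$ consists of functions $f_i:\{0,1\}^n\to\{0,1\}$ ($i\in[m]$) and $g_o:\{0,1\}^n\to\mathcal O$ ($o\in\mathcal O'$) such that $S(f(x),o)$ implies $R(x,g_o(x))$ for all $x$ and $o$, where $f(x)=(f_1(x),\dots,f_m(x))$. Its depth $d$ is the maximum of the decision-tree depths of the $f_i$ and $g_o$, and its complexity is $\log_2 m+d$. For sequences $R=(R_n)$ and $S=(S_m)$ of total query search problems, $R\le_{dt}S$ means that there are constants $k$ and $C$ such that for all large enough $n$ there are an $m$ and an $S_m$-formulation of $R_n$ of complexity at most $C(\log_2 N_n)^k$, where $N_n$ is the number of input bits of $R_n$. Let $S^{dt}$ be the class of all $R$ with $R\le_{dt}S$. Linear Ordering Principle ($\mathrm{LOP}$): given $\prec\,:[2^n]\times[2^n]\to\{0,1\}$ ($2^{2n}$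 input bits), output either some $x$ such that $x\prec y$ for every $y\ne x$, or a violation of the linear ordering axioms, namely (i) some $x$ with $x\prec x$, or (ii) $x\neq y$ with $x\not\prec y$ and $y\not\prec x$, or (iii) $x,y,z$ with $x\ne y$, $y\neq z$, $x\prec y$, $y\prec z$ and $x\not\prec z$. Least Number ($\mathrm{LeastNumber}$): given $f:\{0,\dots,m-1\}\to\{0,1\}$ ($m$ input bits, $m\in\mathbb N$; for $m=2^k$ these are the functions on $k$-bit numbers), output either $\bot$ if $f(x)=0$ for all $x$, or $x$ such that $f(x)=1$ and $f(y)=0$ for all $y<x$. Theorem. $\mathrm{LOP}\notin\mathrm{LeastNumber}^{dt}$. That is, there is no efficient decision-tree reduction from $\mathrm{LOP}$ to $\mathrm{LeastNumber}$. -/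

import Mathlib

/-- A decision tree that queries the bits `x v`, `v : V`, of an input `x : V → Bool`
and whose leaves carry values in `α`. -/
inductive DecisionTree (V α : Type) : Type where
  | leaf (a : α) : DecisionTree V α
  | query (v : V) (ifFalse ifTrue : DecisionTree V α) : DecisionTree V α

namespace DecisionTree

/-- The value computed by the tree on input `x`. -/
def eval {V α : Type} : DecisionTree V α → (V → Bool) → α
  | leaf a, _ => a
  | query v t₀ t₁, x => if x v = true then t₁.eval x else t₀.eval x

/-- The number of queries on a longest root-to-leaf path. -/
def depth {V α : Type} : DecisionTree V α → ℕ
  | leaf _ => 0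
  | query _ t₀ t₁ => max t₀.depth t₁.depth + 1

end DecisionTree

/-- `f` has decision-tree depth at most `d`: some decision tree of depth at most `d` computes it. -/
def HasDepthLE {V α : Type} (f : (V → Bool) → α) (d : ℕ) : Prop :=
  ∃ T : DecisionTree V α, (∀ x, T.eval x = f x) ∧ T.depth ≤ d

/-- A single total query search problem: a relation between bit strings, whose bits are indexed
by the finite type `Var`, and outputs, such that every bit string has an output. -/
structure SearchProblem where
  /-- names of the input bits -/
  Var : Type
  /-- there are finitely many input bits -/
  fintypeVar : Fintype Var
  /-- possible outputs -/
  Out : Type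
  /-- `Rel x o`: the output `o` is a solution on input `x` -/
  Rel : (Var → Bool) → Out → Prop
  /-- every input has a solution -/
  total : ∀ x, ∃ o, Rel x o

/-- The number of input bits. -/
def SearchProblem.size (R : SearchProblem) : ℕ := @Fintype.card R.Var R.fintypeVar

/-- An `S`-formulation of `R`. -/
structure Formulation (R S : SearchProblem) where
  /-- the functions computing the bits of the `S`-instance from the `R`-instance -/
  f : S.Var → (R.Var → Bool) → Bool
  /-- the functions turning an output of `S` into an output of `R`, given the `R`-instance -/
  g : S.Out → (R.Var → Bool) → R.Out
  /-- solutions are mapped to solutions -/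
  correct : ∀ (x : R.Var → Bool) (o : S.Out), S.Rel (fun i => f i x) o → R.Rel x (g o x)

/-- All the functions of the formulation have decision-tree depth at most `d`. -/
def Formulation.DepthLE {R S : SearchProblem} (F : Formulation R S) (d : ℕ) : Prop :=
  (∀ i, HasDepthLE (F.f i) d) ∧ ∀ o, HasDepthLE (F.g o) d

/-- The complexity of reducing `R` to `S` is at most `c`: there is an `S`-formulation of `R` for
which `log m + d ≤ c`, where `m` is its size (the number of input bits of `S`) and `d` its depth. -/
def ComplexityLE (R S : SearchProblem) (c : ℝ) : Prop :=
  ∃ (F : Formulation R S) (d : ℕ), F.DepthLE d ∧ Real.logb 2 (S.size : ℝ) + (d : ℝ) ≤ c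

/-- `R ≤_dt S` for sequences of total search problems: the complexity of reducing `R n` to (the
best member of) the sequence `S` is polylogarithmic in the number of input bits of `R n`. -/
def DTReducible (R S : ℕ → SearchProblem) : Prop :=
  ∃ (k : ℕ) (C : ℝ), ∀ᶠ n in Filter.atTop, ∃ m : ℕ,
    ComplexityLE (R n) (S m) (C * Real.logb 2 ((R n).size : ℝ) ^ k)

/-- The class `S^dt` of all sequences of total search problems that have an efficient
decision-tree reduction to `S`. -/
def dtClass (S : ℕ → SearchProblem) : Set (ℕ → SearchProblem) :=
  {R | DTReducible R S}

/-- Possible outputs of the Linear Ordering Principle on the universe `Fin N`. -/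
inductive LOPOut (N : ℕ) : Type where
  | minimal (x : Fin N) : LOPOut N
  | irrefl (x : Fin N) : LOPOut N
  | totality (x y : Fin N) : LOPOut N
  | trans (x y z : Fin N) : LOPOut N

/-- The solutions of the Linear Ordering Principle; the bit `p (x, y)` says whether `x ≺ y`.
In a transitivity violation `z = x` is allowed, so that `x ≺ y ≺ x` is a violation as well
(of transitivity if `x ⊀ x`, of irreflexivity otherwise). -/
def LOPRel {N : ℕ} (p : Fin N × Fin N → Bool) : LOPOut N → Prop
  | .minimal x => ∀ y, y ≠ x → p (x, y) = true
  | .irrefl x => p (x, x) = true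
  | .totality x y => x ≠ y ∧ p (x, y) = false ∧ p (y, x) = false
  | .trans x y z => x ≠ y ∧ y ≠ z ∧ p (x, y) = true ∧ p (y, z) = true ∧ p (x, z) = false

theorem LOPRel_total {N : ℕ} (hN : 0 < N) (p : Fin N × Fin N → Bool) : ∃ o, LOPRel p o := by
  by_contra! hno
  have hirr : ∀ x, ¬ p (x, x) = true := fun x h => hno (.irrefl x) h
  have htot : ∀ x y, x ≠ y → p (x, y) = false → p (y, x) = true := by
    intro x y hxy h
    by_contra h'
    exact hno (.totality x y) ⟨hxy, h, by simpa using h'⟩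
  have htr : ∀ x y z, p (x, y) = true → p (y, z) = true → p (x, z) = true := by
    intro x y z h1 h2
    by_contra h3
    refine hno (.trans x y z) ⟨?_, ?_, h1, h2, by simpa using h3⟩
    · rintro rfl
      exact hirr _ h1
    · rintro rfl
      exact hirr _ h2
  have : IsTrans (Fin N) (fun x y => p (x, y) = true) := ⟨htr⟩
  have : Std.Irrefl (fun x y : Fin N => p (x, y) = true) := ⟨hirr⟩
  obtain ⟨x, -, hx⟩ := (Finite.wellFounded_of_trans_of_irrefl
    (fun x y : Fin N => p (x, y) = true)).has_min Set.univ ⟨⟨0, hN⟩, trivial⟩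
  refine hno (.minimal x) fun y hy => ?_
  exact htot y x hy (by simpa using hx y trivial)

/-- The Linear Ordering Principle on the `2 ^ n`-element universe, with `2 ^ n * 2 ^ n` input
bits. -/
def LOP (n : ℕ) : SearchProblem where
  Var := Fin (2 ^ n) × Fin (2 ^ n)
  fintypeVar := inferInstance
  Out := LOPOut (2 ^ n)
  Rel := LOPRel
  total := LOPRel_total (by positivity)

/-- The solutions of Least Number: `none` (that is, `⊥`) if `f` is identically `0`, and `some x`
if `x` is the least number with `f x = 1`. -/
def LeastNumberRel {m : ℕ} (f : Fin m → Bool) : Option (Fin m) → Prop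
  | none => ∀ x, f x = false
  | some x => f x = true ∧ ∀ y, y < x → f y = false

theorem LeastNumberRel_total {m : ℕ} (f : Fin m → Bool) : ∃ o, LeastNumberRel f o := by
  by_cases h : ∃ x, f x = true
  · obtain ⟨x, hx, hmin⟩ := (wellFounded_lt (α := Fin m)).has_min {x | f x = true} h
    exact ⟨some x, hx, fun y hy => by simpa using fun hy' => hmin y hy' hy⟩
  · exact ⟨none, fun x => by simpa using fun hx => h ⟨x, hx⟩⟩

/-- Least Number for functions `f : Fin m → {0,1}`, with `m` input bits, for every length `m` (the
lengths `m = 2 ^ k` are the functions on `k`-bit numbers). -/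
def LeastNumber (m : ℕ) : SearchProblem where
  Var := Fin m
  fintypeVar := inferInstance
  Out := Option (Fin m)
  Rel := LeastNumberRel
  total := LeastNumberRel_total

/-!
Only inputs that are linear orders matter. On such an input a correct answer to `LOP` is the
minimum of the order (`minimal_of_LOPRel_orderInput`), and the minimum is not determined by few
queries: a partial view of the order leaves some element untouched, and that element can be moved
to the bottom without changing any bit that was read (`two_pow_le_of_formulation`).

What `LeastNumber` adds to a decision tree is the right to answer according to the first `f i` that
evaluates to `1`, and on linear orders this costs few queries
(`exists_leastNumberRel_of_agree`): take the least `i` such that `f i` is `1` on *some*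
linear order `p`. All earlier bits vanish on every linear order, so `i` is the solution of the
`LeastNumber` instance on every linear order that agrees with `p` on the at most `d` bits read by
`f i`. If there is no such `i`, the solution is `⊥` on all linear orders.
Reading `g i` as well costs another `d` bits, so the two trees touch at most `4 * d` elements, and
`2 ^ n ≤ 4 * d + 1` follows. The length `m` plays no role. This contradicts `d` being polynomial
in `n`.
-/

/-- A run of a decision tree is determined by the bits that it reads. -/
theorem DecisionTree.exists_finset_eval_eq {V α : Type} [DecidableEq V] (T : DecisionTree V α)
    (x : V → Bool) : ∃ Q : Finset V, Q.card ≤ T.depth ∧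
      ∀ y : V → Bool, (∀ v ∈ Q, y v = x v) → T.eval y = T.eval x := by
  induction T with
  | leaf a => exact ⟨∅, by simp, fun _ _ => rfl⟩
  | query v t₀ t₁ ih₀ ih₁ =>
    obtain ⟨Q₀, hc₀, h₀⟩ := ih₀
    obtain ⟨Q₁, hc₁, h₁⟩ := ih₁
    by_cases hv : x v = true
    · refine ⟨insert v Q₁, (Finset.card_insert_le _ _).trans ?_, fun y hy => ?_⟩
      · simp only [DecisionTree.depth]; omega
      · have hyv : y v = true := (hy v (Finset.mem_insert_self _ _)).trans hv
        simpa [DecisionTree.eval, hv, hyv] using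
          h₁ y fun w hw => hy w (Finset.mem_insert_of_mem hw)
    · refine ⟨insert v Q₀, (Finset.card_insert_le _ _).trans ?_, fun y hy => ?_⟩
      · simp only [DecisionTree.depth]; omega
      · have hyv : ¬ y v = true := by rwa [hy v (Finset.mem_insert_self _ _)]
        simpa [DecisionTree.eval, hv, hyv] using
          h₀ y fun w hw => hy w (Finset.mem_insert_of_mem hw)

theorem HasDepthLE.exists_finset_eq {V α : Type} [DecidableEq V] {f : (V → Bool) → α} {d : ℕ}
    (hf : HasDepthLE f d) (x : V → Bool) : ∃ Q : Finset V, Q.card ≤ d ∧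
      ∀ y : V → Bool, (∀ v ∈ Q, y v = x v) → f y = f x := by
  obtain ⟨T, hT, hd⟩ := hf
  obtain ⟨Q, hQ, h⟩ := T.exists_finset_eval_eq x
  exact ⟨Q, hQ.trans hd, fun y hy => by rw [← hT, ← hT, h y hy]⟩

/-- The `LOP` input that orders the elements by their ranks `s`; it is a linear order when `s` is
injective. Ranks are integers so that there is always room below a given element. -/
def orderInput {N : ℕ} (s : Fin N → ℤ) : Fin N × Fin N → Bool :=
  fun v => decide (s v.1 < s v.2)

/-- On a linear order, the only solution of `LOP` is the minimum. -/
theorem minimal_of_LOPRel_orderInput {N : ℕ} {s : Fin N → ℤ} (hs : Function.Injective s)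
    {o : LOPOut N} (h : LOPRel (orderInput s) o) :
    ∃ x, o = .minimal x ∧ ∀ y, y ≠ x → s x < s y := by
  cases o with
  | minimal x => exact ⟨x, rfl, fun y hy => by simpa [orderInput] using h y hy⟩
  | irrefl x => simp [LOPRel, orderInput] at h
  | totality x y =>
    simp only [LOPRel, orderInput, decide_eq_false_iff_not, not_lt] at h
    exact absurd (hs (le_antisymm h.2.2 h.2.1)) h.1
  | trans x y z =>
    simp only [LOPRel, orderInput, decide_eq_true_eq, decide_eq_false_iff_not] at h
    exact absurd (h.2.2.1.trans h.2.2.2.1) h.2.2.2.2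

/-- Some element outside a small set of elements can be moved to the bottom of a linear order
without changing the order between any other elements. -/
theorem exists_injective_lt_of_card_lt {N : ℕ} {s : Fin N → ℤ} (hs : Function.Injective s)
    {E : Finset (Fin N)} (hE : E.card < N) :
    ∃ z ∉ E, ∃ t : Fin N → ℤ, Function.Injective t ∧ (∀ y, y ≠ z → t y = s y) ∧
      ∀ y, y ≠ z → t z < t y := by
  obtain ⟨z, hz⟩ : ∃ z, z ∉ E := by
    by_contra! h
    rw [Finset.eq_univ_of_forall h, Finset.card_fin] at hE
    exact hE.false
  obtain ⟨b, hb⟩ := (Set.finite_range s).bddBelow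
  have hb' : ∀ y, b ≤ s y := fun y => hb ⟨y, rfl⟩
  refine ⟨z, hz, Function.update s z (b - 1), fun u v huv => ?_,
    fun y hy => Function.update_of_ne hy _ _, fun y hy => ?_⟩
  · have hu := hb' u
    have hv := hb' v
    by_cases hu' : u = z <;> by_cases hv' : v = z
    · rw [hu', hv']
    · subst hu'
      rw [Function.update_self, Function.update_of_ne hv'] at huv
      omega
    · subst hv'
      rw [Function.update_self, Function.update_of_ne hu'] at huv
      omega
    · rw [Function.update_of_ne hu', Function.update_of_ne hv'] at huv
      exact hs huv
  · rw [Function.update_self, Function.update_of_ne hy]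
    have := hb' y
    omega

/-- On linear orders, some answer of a `LeastNumber` instance is certified by few queries. -/
theorem exists_leastNumberRel_of_agree {N m d : ℕ}
    (f : Fin m → (Fin N × Fin N → Bool) → Bool) (hf : ∀ i, HasDepthLE (f i) d) :
    ∃ (o : Option (Fin m)) (s : Fin N → ℤ) (Q : Finset (Fin N × Fin N)),
      Function.Injective s ∧ Q.card ≤ d ∧ ∀ t : Fin N → ℤ, Function.Injective t →
        (∀ v ∈ Q, orderInput t v = orderInput s v) →
          LeastNumberRel (fun i => f i (orderInput t)) o := by
  by_cases h : ∃ i, ∃ s : Fin N → ℤ, Function.Injective s ∧ f i (orderInput s) = true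
  · obtain ⟨i, ⟨s, hs, hi⟩, hmin⟩ := (wellFounded_lt (α := Fin m)).has_min
      {i | ∃ s : Fin N → ℤ, Function.Injective s ∧ f i (orderInput s) = true} h
    obtain ⟨Q, hQ, hQf⟩ := (hf i).exists_finset_eq (orderInput s)
    refine ⟨some i, s, Q, hs, hQ, fun t ht hag => ⟨(hQf _ hag).trans hi, fun j hj => ?_⟩⟩
    exact Bool.eq_false_iff.2 fun hj' => hmin j ⟨t, ht, hj'⟩ hj
  · refine ⟨none, fun a => (a : ℤ), ∅, fun a b hab => ?_, by simp, fun t ht _ i => ?_⟩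
    · exact Fin.ext (Nat.cast_injective hab)
    · exact Bool.eq_false_iff.2 fun hi => h ⟨i, t, ht, hi⟩

/-- A reduction of `LOP` to `LeastNumber` has depth linear in the size of the universe. -/
theorem two_pow_le_of_formulation {n m d : ℕ} (F : Formulation (LOP n) (LeastNumber m))
    (hF : F.DepthLE d) : 2 ^ n ≤ 4 * d + 1 := by
  by_contra! hlt
  obtain ⟨o, s, Q, hs, hQ, hsol⟩ := exists_leastNumberRel_of_agree (N := 2 ^ n) F.f hF.1
  obtain ⟨Q', hQ', hg⟩ :=
    HasDepthLE.exists_finset_eq (V := Fin (2 ^ n) × Fin (2 ^ n)) (hF.2 o) (orderInput s)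
  obtain ⟨x, hx, -⟩ := minimal_of_LOPRel_orderInput hs
    (F.correct (orderInput s) o (hsol s hs fun _ _ => rfl))
  -- the elements that must stay in place: those read by either tree, and the answer `x`
  let E : Finset (Fin (2 ^ n)) :=
    insert x ((Q ∪ Q').image Prod.fst ∪ (Q ∪ Q').image Prod.snd)
  have hE : E.card < 2 ^ n := by
    have h₁ : E.card ≤ _ := Finset.card_insert_le _ _
    have h₂ := Finset.card_union_le ((Q ∪ Q').image Prod.fst) ((Q ∪ Q').image Prod.snd)
    have h₃ := Finset.card_image_le (s := Q ∪ Q') (f := Prod.fst)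
    have h₄ := Finset.card_image_le (s := Q ∪ Q') (f := Prod.snd)
    have h₅ := Finset.card_union_le Q Q'
    omega
  obtain ⟨z, hz, t, ht, hts, hzt⟩ := exists_injective_lt_of_card_lt hs hE
  have hag : ∀ v ∈ Q ∪ Q', orderInput t v = orderInput s v := by
    intro v hv
    have h₁ : v.1 ≠ z := by
      rintro rfl
      exact hz (Finset.mem_insert_of_mem
        (Finset.mem_union_left _ (Finset.mem_image_of_mem _ hv)))
    have h₂ : v.2 ≠ z := by
      rintro rfl
      exact hz (Finset.mem_insert_of_mem
        (Finset.mem_union_right _ (Finset.mem_image_of_mem _ hv)))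
    rw [orderInput, orderInput, hts _ h₁, hts _ h₂]
  have hxz : x ≠ z := by
    rintro rfl
    exact hz (Finset.mem_insert_self _ _)
  obtain ⟨x', hx', hmin⟩ := minimal_of_LOPRel_orderInput ht (F.correct (orderInput t) o
    (hsol t ht fun v hv => hag v (Finset.mem_union_left _ hv)))
  rw [hg _ fun v hv => hag v (Finset.mem_union_right _ hv), hx] at hx'
  cases hx'
  exact lt_asymm (hmin z hxz.symm) (hzt x hxz)

theorem logb_size_LOP (n : ℕ) : Real.logb 2 ((LOP n).size : ℝ) = 2 * n := by
  have h : (LOP n).size = 2 ^ (2 * n) := by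
    change Fintype.card (Fin (2 ^ n) × Fin (2 ^ n)) = _
    rw [Fintype.card_prod, Fintype.card_fin, two_mul, pow_add]
  rw [h, Nat.cast_pow, Nat.cast_ofNat, Real.logb_pow, Real.logb_self_eq_one one_lt_two]
  push_cast
  ring

theorem eventually_polynomial_lt_two_pow (k : ℕ) (C : ℝ) :
    ∀ᶠ n : ℕ in Filter.atTop, 4 * (C * (2 * (n : ℝ)) ^ k) + 1 < 2 ^ n := by
  have ho := (isLittleO_pow_const_const_pow_of_one_lt (R := ℝ) k one_lt_two).const_mul_left
    (4 * C * 2 ^ k)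
  filter_upwards [ho.bound (c := 1 / 2) (by norm_num), Filter.eventually_ge_atTop 2] with n hn h2
  have h4 : (2 : ℝ) ^ 2 ≤ 2 ^ n := pow_le_pow_right₀ one_le_two h2
  rw [Real.norm_of_nonneg (by positivity : (0 : ℝ) ≤ 2 ^ n)] at hn
  have := (Real.le_norm_self _).trans hn
  rw [mul_pow]
  linarith

theorem theorem2 : LOP ∉ dtClass LeastNumber := by
  rintro ⟨k, C, h⟩
  obtain ⟨n, ⟨m, F, d, hF, hle⟩, hlt⟩ := (h.and (eventually_polynomial_lt_two_pow k C)).exists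
  rw [logb_size_LOP] at hle
  -- this includes `m = 0`, where the logarithm is `0` by convention
  have hm : 0 ≤ Real.logb 2 ((LeastNumber m).size : ℝ) :=
    div_nonneg (Real.log_natCast_nonneg _) (Real.log_nonneg one_le_two)
  have hd : (2 : ℝ) ^ n ≤ 4 * d + 1 := by exact_mod_cast two_pow_le_of_formulation F hF
  linarith
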